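/- Let $\mathcal T$ be a triangulated category with suspension $\Sigma$. For a class $\mathcal X$ of objects let $\operatorname{add}\mathcal X$ be the smallest full subcategory containing $\mathcal X$ that is closed under finite direct sums and direct summands. For an object $X$ put $\operatorname{thick}^0(X)=\operatorname{add}\varnothing$, $\operatorname{thick}^1(X)=\operatorname{add}\{\Sigma^iX\mid i\in\mathbb Z\}$, and for $n>1$ let $\operatorname{thick}^n(X)=\operatorname{add}\{\operatorname{cone}\varphi\mid \varphi\colon U\to V,\ U\in\operatorname{thick}^1(X),\ V\in\operatorname{thick}^{n-1}(X)\}$. Write $h(X,Y)\le n$ if $|i-j|<n$ for all $i,j\in\mathbb Z$ with $\operatorname{Hom}(X,\Sigma^iY)\ne0\ne\operatorname{Hom}(X,\Sigma^jY)$, and let $\hom^n(X)=\{Y\in\mathcal T\mid h(X,Y)\le n\}$. The object $X$ is a *finitistic generator* of $\mathcal T$ if for every $Y\in\mathcal T$ there is $n$ with $h(X,Y)\le n$, and $\hom^p(X)\subseteq\operatorname{thick}^p(X)$ for all $p\ge0$. Let $\operatorname{amp}(X)=\sup\{|n|\mid \operatorname{Hom}(X,\Sigma^nX)\neq0\}$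 (with $\sup\varnothing=0$), and let $\operatorname{fin.dim}\mathcal T$ be the infimum of $\operatorname{amp}(X)$ over all finitistic generators $X$ of $\mathcal T$ ($\infty$ if there is none). For a ring $A$ let $\operatorname{fin.dim}A$ be the supremum of the projective dimensions of the $A$-modules that admit a finite resolution by finitely generated projective modules (the zero module being given projective dimension $0$). Let $\operatorname{Perf}(A)$ be the triangulated category of perfect complexes, i.e. the full subcategory of the derived category of $A$-modules consisting of the objects isomorphic to a bounded complex of finitely generated projective modules, and regard $A$ as an object of $\operatorname{Perf}(A)$ in degree $0$. **Theorem.** For every ring $A$, $$\operatorname{fin.dim}A<\infty\iff\operatorname{fin.dim}\operatorname{Perf}(A)<\infty,\qquad\text{and}\qquad \operatorname{fin.dim}\operatorname{Perf}(A)\le\operatorname{fin.dim}A .$$ Moreover, if $X$ is a finitistic generator of $\operatorname{Perf}(A)$, then there are $p,q\ge0$ with $$\hom^1(A)\subseteq\hom^p(X),\qquad \operatorname{thick}^1(X)\subseteq\operatorname{thick}^q(A),\qquad \operatorname{fin.dim}A<p+q ;$$ and if $A\neq0$, then every pair $p,q\ge0$ satisfying these two inclusions satisfies $\operatorname{fin.dim}A<pq$.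 -/

import Mathlib

open CategoryTheory Category Limits Pretriangulated

universe u

namespace FinitisticDimension

section Triangulated

variable {C : Type*} [Category* C] [HasZeroObject C] [HasShift C ℤ] [Preadditive C]
  [∀ n : ℤ, (shiftFunctor C n).Additive] [Pretriangulated C]

/-- `add P`: the smallest full subcategory containing `P` that is closed under finite direct sums
and direct summands. (In a pretriangulated category every retract is a direct summand; closure
under isomorphisms is the special case of retracts given by isomorphisms.) -/
inductive add (P : ObjectProperty C) : ObjectProperty C
  | of (X : C) (hX : P X) : add P X
  | zero (X : C) (hX : IsZero X) : add P X
  | biprod (X Y : C) (hX : add P X) (hY : add P Y) : add P (X ⊞ Y)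
  | retract (X Y : C) (r : Retract X Y) (hY : add P Y) : add P X

/-- The objects `Z` that are a cone of some morphism `φ : U ⟶ V` with `U` in `P` and `V` in `Q`. -/
def cones (P Q : ObjectProperty C) : ObjectProperty C := fun Z =>
  ∃ (U V : C) (φ : U ⟶ V) (g : V ⟶ Z) (h : Z ⟶ U⟦(1 : ℤ)⟧),
    P U ∧ Q V ∧ Triangle.mk φ g h ∈ distTriang C

/-- The objects isomorphic to some shift `X⟦i⟧` with `i : ℤ`. -/
def shifts (X : C) : ObjectProperty C := fun Y => ∃ i : ℤ, Nonempty (Y ≅ X⟦i⟧)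

/-- `thick X n` is the full subcategory of objects built from `X` in at most `n` steps. -/
def thick (X : C) : ℕ → ObjectProperty C
  | 0 => add ⊥
  | 1 => add (shifts X)
  | n + 2 => add (cones (add (shifts X)) (thick X (n + 1)))

/-- `HomLE X Y n` is the relation `h(X, Y) ≤ n`: whenever `Hom(X, Y⟦i⟧)` and `Hom(X, Y⟦j⟧)` are
both non-zero, then `|i - j| < n`. -/
def HomLE (X Y : C) (n : ℕ) : Prop :=
  ∀ i j : ℤ, Nontrivial (X ⟶ Y⟦i⟧) → Nontrivial (X ⟶ Y⟦j⟧) → |i - j| < (n : ℤ)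

/-- `hom X n` is the full subcategory of the objects `Y` with `h(X, Y) ≤ n`. -/
def hom (X : C) (n : ℕ) : ObjectProperty C := fun Y => HomLE X Y n

/-- The amplitude of `X`, the supremum of the `|n|` with `Hom(X, X⟦n⟧) ≠ 0`. -/
noncomputable def amp (X : C) : ℕ∞ :=
  ⨆ (n : ℤ) (_ : Nontrivial (X ⟶ X⟦n⟧)), (n.natAbs : ℕ∞)

/-- `X` is homologically finite if `h(X, Y) < ∞` for every object `Y`. -/
def IsHomologicallyFinite (X : C) : Prop := ∀ Y : C, ∃ n : ℕ, HomLE X Y n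

/-- Finitistic generators of a triangulated category. -/
structure IsFinitisticGenerator (X : C) : Prop where
  homologicallyFinite : IsHomologicallyFinite X
  hom_le_thick (p : ℕ) : hom X p ≤ thick X p

variable (C) in
/-- The finitistic dimension of a triangulated category: the infimum of the amplitudes of the
finitistic generators (`⊤` if there is none). -/
noncomputable def triangulatedFinDim : ℕ∞ :=
  ⨅ (X : C) (_ : IsFinitisticGenerator X), amp X

end Triangulated

section Ring

variable (A : Type u) [Ring A]

/-- The class `𝒫(A)` of the `A`-modules with a finite resolution by finitely generated projective
modules. -/
def finiteResolution : ObjectProperty (ModuleCat.{u} A) := fun M =>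
  ∃ R : ProjectiveResolution M, (∀ i : ℕ, Module.Finite A (R.complex.X i)) ∧
    ∃ n : ℕ, ∀ i : ℕ, n < i → IsZero (R.complex.X i)

/-- The small finitistic dimension of `A`. The zero module, whose Mathlib projective dimension
is `⊥`, contributes `0` to the supremum. -/
noncomputable def ringFinDim : ℕ∞ :=
  ⨆ (M : ModuleCat.{u} A) (_ : finiteResolution A M), (projectiveDimension M).unbotD 0

/-- The derived category of `A`-modules is the standard localization of the category of
complexes at the quasi-isomorphisms. -/
noncomputable instance : HasDerivedCategory.{u + 1} (ModuleCat.{u} A) :=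
  HasDerivedCategory.standard _

variable {A} in
/-- Bounded cochain complexes of finitely generated projective `A`-modules. -/
structure IsStrictlyPerfect (K : CochainComplex (ModuleCat.{u} A) ℤ) : Prop where
  bounded : ∃ a b : ℤ, K.IsStrictlyGE a ∧ K.IsStrictlyLE b
  finite (n : ℤ) : Module.Finite A (K.X n)
  projective (n : ℤ) : Module.Projective A (K.X n)

/-- The perfect complexes: the objects of the derived category of `A` that are isomorphic to a
bounded complex of finitely generated projective modules. -/
def perf : ObjectProperty (DerivedCategory (ModuleCat.{u} A)) := fun X =>
  ∃ K : CochainComplex (ModuleCat.{u} A) ℤ, IsStrictlyPerfect K ∧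
    Nonempty (X ≅ DerivedCategory.Q.obj K)

variable {A}

lemma IsStrictlyPerfect.isKProjective {K : CochainComplex (ModuleCat.{u} A) ℤ}
    (hK : IsStrictlyPerfect K) : K.IsKProjective := by
  obtain ⟨a, b, _, _⟩ := hK.bounded
  have (n : ℤ) : Projective (K.X n) := by
    have := hK.projective n
    exact (IsProjective.iff_projective (K.X n)).1 inferInstance
  exact CochainComplex.isKProjective_of_projective K b

lemma IsStrictlyPerfect.shift {K : CochainComplex (ModuleCat.{u} A) ℤ}
    (hK : IsStrictlyPerfect K) (n : ℤ) : IsStrictlyPerfect (K⟦n⟧) where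
  bounded := by
    obtain ⟨a, b, _, _⟩ := hK.bounded
    exact ⟨a - n, b - n, K.isStrictlyGE_shift a n _ (by lia), K.isStrictlyLE_shift b n _ (by lia)⟩
  finite i := hK.finite (i + n)
  projective i := hK.projective (i + n)

lemma IsStrictlyPerfect.mappingCone {K L : CochainComplex (ModuleCat.{u} A) ℤ} (f : K ⟶ L)
    (hK : IsStrictlyPerfect K) (hL : IsStrictlyPerfect L) :
    IsStrictlyPerfect (CochainComplex.mappingCone f) := by
  have e (n : ℤ) : (CochainComplex.mappingCone f).X n ≅ ModuleCat.of A (K.X (n + 1) × L.X n) :=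
    HomologicalComplex.homotopyCofiber.XIsoBiprod f n (n + 1) rfl ≪≫
      ModuleCat.biprodIsoProd _ _
  refine ⟨?_, fun n => ?_, fun n => ?_⟩
  · obtain ⟨a, b, _, _⟩ := hK.bounded
    obtain ⟨a', b', _, _⟩ := hL.bounded
    refine ⟨min (a - 1) a', max b b', CochainComplex.isStrictlyGE_mappingCone f a a' _, ?_⟩
    rw [CochainComplex.isStrictlyLE_iff]
    intro i hi
    rw [CochainComplex.mappingCone.isZero_X_iff]
    exact ⟨K.isZero_of_isStrictlyLE b _, L.isZero_of_isStrictlyLE b' _⟩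
  · have := hK.finite (n + 1)
    have := hL.finite n
    exact Module.Finite.equiv (e n).toLinearEquiv.symm
  · have := hK.projective (n + 1)
    have := hL.projective n
    exact Module.Projective.of_equiv (e n).toLinearEquiv.symm

lemma isStrictlyPerfect_single (n : ℤ) (P : ModuleCat.{u} A) [Module.Finite A P]
    [Module.Projective A P] :
    IsStrictlyPerfect ((CochainComplex.singleFunctor (ModuleCat.{u} A) n).obj P) := by
  have hz (i : ℤ) (hi : i ≠ n) :
      Subsingleton (((CochainComplex.singleFunctor (ModuleCat.{u} A) n).obj P).X i) :=
    ModuleCat.isZero_iff_subsingleton.1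
      (HomologicalComplex.isZero_single_obj_X (ComplexShape.up ℤ) n P i hi)
  have e : ((CochainComplex.singleFunctor (ModuleCat.{u} A) n).obj P).X n ≅ P :=
    HomologicalComplex.singleObjXSelf (ComplexShape.up ℤ) n P
  refine ⟨⟨n, n, inferInstance, inferInstance⟩, fun i => ?_, fun i => ?_⟩
  · by_cases hi : i = n
    · subst hi
      exact Module.Finite.equiv e.toLinearEquiv.symm
    · have := hz i hi
      infer_instance
  · by_cases hi : i = n
    · subst hi
      exact Module.Projective.of_equiv e.toLinearEquiv.symm
    · have := hz i hi
      infer_instance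

instance : (perf A).IsClosedUnderIsomorphisms where
  of_iso e := by
    rintro ⟨K, hK, ⟨e'⟩⟩
    exact ⟨K, hK, ⟨e.symm ≪≫ e'⟩⟩

instance : (perf A).ContainsZero where
  exists_zero := by
    refine ⟨(DerivedCategory.Q).obj ((CochainComplex.singleFunctor (ModuleCat.{u} A) 0).obj
      (ModuleCat.of A PUnit)), ?_, _, isStrictlyPerfect_single 0 _, ⟨Iso.refl _⟩⟩
    exact Functor.map_isZero _ (Functor.map_isZero _
      (ModuleCat.isZero_of_subsingleton _))

instance : (perf A).IsStableUnderShift ℤ where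
  isStableUnderShiftBy n :=
    { le_shift := by
        rintro X ⟨K, hK, ⟨e⟩⟩
        exact ⟨K⟦n⟧, hK.shift n, ⟨(shiftFunctor _ n).mapIso e ≪≫
          ((DerivedCategory.Q.commShiftIso n).app K).symm⟩⟩ }

instance : (perf A).IsTriangulatedClosed₃ := .mk' (by
  rintro T hT ⟨K, hK, ⟨eK⟩⟩ ⟨L, hL, ⟨eL⟩⟩
  have := hK.isKProjective
  obtain ⟨f, hf⟩ : ∃ f : K ⟶ L, DerivedCategory.Q.map f = eK.inv ≫ T.mor₁ ≫ eL.hom := by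
    obtain ⟨g, hg⟩ := (CochainComplex.IsKProjective.Qh_map_bijective K
      ((HomotopyCategory.quotient _ _).obj L)).surjective
        ((DerivedCategory.quotientCompQhIso _).hom.app K ≫ (eK.inv ≫ T.mor₁ ≫ eL.hom) ≫
          (DerivedCategory.quotientCompQhIso _).inv.app L)
    obtain ⟨f, rfl⟩ := (HomotopyCategory.quotient _ _).map_surjective g
    refine ⟨f, ?_⟩
    have h := (DerivedCategory.quotientCompQhIso (ModuleCat.{u} A)).hom.naturality f
    rw [← cancel_epi ((DerivedCategory.quotientCompQhIso (ModuleCat.{u} A)).hom.app K), ← h]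
    dsimp
    rw [hg]
    simp
  refine ⟨CochainComplex.mappingCone f, hK.mappingCone f hL, ⟨?_⟩⟩
  exact Triangle.π₃.mapIso (isoTriangleOfIso₁₂ T
    (DerivedCategory.Q.mapTriangle.obj (CochainComplex.mappingCone.triangle f)) hT
    (by rw [DerivedCategory.mem_distTriang_iff]; exact ⟨K, L, f, ⟨Iso.refl _⟩⟩)
    eK eL (by
      change T.mor₁ ≫ eL.hom = eK.hom ≫ DerivedCategory.Q.map f
      rw [hf, Iso.hom_inv_id_assoc])))

instance : (perf A).IsTriangulated where
  toIsTriangulatedClosed₂ := .of_isTriangulatedClosed₃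

variable (A)

/-- The triangulated category of perfect complexes over `A`, as a full triangulated subcategory
of the derived category of `A`. -/
abbrev Perf := (perf A).FullSubcategory

/-- The ring `A` as a complex concentrated in degree zero, viewed as an object of `Perf A`. -/
noncomputable def ringPerf : Perf A :=
  ⟨(DerivedCategory.singleFunctor (ModuleCat.{u} A) 0).obj (ModuleCat.of A A), _,
    isStrictlyPerfect_single 0 _,
    ⟨(DerivedCategory.singleFunctorIsoCompQ (ModuleCat.{u} A) 0).app _⟩⟩

end Ring

end FinitisticDimension

/-! Since Hom(A, Σ^i Y) vanishes exactly when H^i(Y) does, h(A, Y) ≤ n says that the cohomology of Y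
lies in n consecutive degrees.

Suppose that d = fin.dim A is finite, and let X = A ⊕ ΣA ⊕ ⋯ ⊕ Σ^d A, an object of amplitude at most
d. If a and b are the extreme degrees of the cohomology of Y, then Hom(X, Σ^i Y) ≠ 0 for i = a and i
= b + d, so h(X, Y) ≤ p forces p ≥ (b - a) + (d + 1). That many cones suffice to build Y from A:
killing the top cohomology b - a times with finitely generated projectives leaves a shifted module
in 𝒫(A), which costs d + 1 cones (`exists_finiteResolution_forall_iteratedCones`). Hence X is a
finitistic generator.

Conversely, let X be a finitistic generator. As X is a bounded complex of projectives, some p gives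
hom^1(A) ⊆ hom^p(X); as X is built from A in finitely many steps, q exists. A module M in 𝒫(A) lies
in hom^1(A), hence in thick^p(X). A class in Ext^n(M, N) is a composite of n morphisms vanishing on
cohomology (`composites_ghost_hom`). Composites of q such ghosts vanish on thick^1(X), so by the
ghost lemma composites of pq vanish on thick^p(X), and M has projective dimension less than pq. The
bound p + q follows because p may be enlarged freely. -/

namespace FinitisticDimension

/-! ### Shifts of an object -/

section Shifts

variable {C : Type*} [Category* C] [HasShift C ℤ]

lemma shifts_shift {X Y : C} (n : ℤ) (h : shifts X Y) : shifts X (Y⟦n⟧) := by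
  obtain ⟨i, ⟨e⟩⟩ := h
  exact ⟨i + n, ⟨(shiftFunctor C n).mapIso e ≪≫ (shiftFunctorAdd C i n).symm.app X⟩⟩

lemma shifts_self (X : C) : shifts X X := ⟨0, ⟨((shiftFunctorZero C ℤ).app X).symm⟩⟩

end Shifts

lemma hom_mono {C : Type*} [Category* C] [Preadditive C] [HasShift C ℤ] (X : C) {m n : ℕ}
    (hmn : m ≤ n) : hom X m ≤ hom X n :=
  fun _ hY i j hi hj => (hY i j hi hj).trans_le (by exact_mod_cast hmn)

/-! ### Additive closures, iterated cones and thick subcategories -/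

section Triangulated

variable {C : Type*} [Category* C] [HasZeroObject C] [HasShift C ℤ] [Preadditive C]
  [∀ n : ℤ, (shiftFunctor C n).Additive] [Pretriangulated C]

lemma add_of_iso {P : ObjectProperty C} {X Y : C} (e : X ≅ Y) (hX : add P X) : add P Y :=
  .retract Y X e.symm.retract hX

lemma add_le_of_le_add {P Q : ObjectProperty C} (h : P ≤ add Q) : add P ≤ add Q := by
  intro X hX
  induction hX with
  | of X hX => exact h X hX
  | zero X hX => exact .zero X hX
  | biprod X Y _ _ hX hY => exact .biprod X Y hX hY
  | retract X Y r _ hY => exact .retract X Y r hY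

lemma add_mono {P Q : ObjectProperty C} (h : P ≤ Q) : add P ≤ add Q :=
  add_le_of_le_add fun X hX => .of X (h X hX)

lemma add_shift {P : ObjectProperty C} (n : ℤ) (hP : ∀ X, P X → P (X⟦n⟧)) {X : C}
    (hX : add P X) : add P (X⟦n⟧) := by
  induction hX with
  | of X hX => exact .of _ (hP X hX)
  | zero X hX => exact .zero _ ((shiftFunctor C n).map_isZero hX)
  | biprod X Y _ _ hX hY =>
    have := preservesBinaryBiproducts_of_preservesBiproducts (shiftFunctor C n)
    exact add_of_iso ((shiftFunctor C n).mapBiprod X Y).symm (.biprod _ _ hX hY)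
  | retract X Y r _ hY => exact .retract _ _ (r.map (shiftFunctor C n)) hY

lemma add_shifts_shift {X Y : C} (n : ℤ) (h : add (shifts X) Y) : add (shifts X) (Y⟦n⟧) :=
  add_shift n (fun _ hY => shifts_shift n hY) h

lemma cones_mono {P P' Q Q' : ObjectProperty C} (hP : P ≤ P') (hQ : Q ≤ Q') :
    cones P Q ≤ cones P' Q' := by
  rintro Z ⟨U, V, φ, g, h, hU, hV, hT⟩
  exact ⟨U, V, φ, g, h, hP U hU, hQ V hV, hT⟩

lemma cones_of_iso {P Q : ObjectProperty C} {Z Z' : C} (e : Z ≅ Z') (hZ : cones P Q Z) :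
    cones P Q Z' := by
  obtain ⟨U, V, φ, g, h, hU, hV, hT⟩ := hZ
  refine ⟨U, V, φ, g ≫ e.hom, e.inv ≫ h, hU, hV, isomorphic_distinguished _ hT _ ?_⟩
  exact Triangle.isoMk _ _ (Iso.refl U) (Iso.refl V) e.symm
    ((comp_id φ).trans (id_comp φ).symm)
    ((assoc g e.hom e.inv).trans <| by
      rw [e.hom_inv_id]
      exact (comp_id g).trans (id_comp g).symm)
    ((congrArg ((e.inv ≫ h) ≫ ·) ((shiftFunctor C (1 : ℤ)).map_id U)).trans (comp_id _))

lemma cones_shift {P Q : ObjectProperty C} (n : ℤ) (hP : ∀ X, P X → P (X⟦n⟧))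
    (hQ : ∀ X, Q X → Q (X⟦n⟧)) {Z : C} (hZ : cones P Q Z) : cones P Q (Z⟦n⟧) := by
  obtain ⟨U, V, φ, g, h, hU, hV, hT⟩ := hZ
  exact ⟨_, _, _, _, _, hP U hU, hQ V hV, Triangle.shift_distinguished _ hT n⟩

/-- The objects obtained from the zero objects by taking `n` times the cone of a morphism from an
object of `P`. -/
def iteratedCones (P : ObjectProperty C) : ℕ → ObjectProperty C
  | 0 => fun X => IsZero X
  | n + 1 => cones P (iteratedCones P n)

lemma iteratedCones_of_iso {P : ObjectProperty C} {n : ℕ} {X Y : C} (e : X ≅ Y)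
    (hX : iteratedCones P n X) : iteratedCones P n Y := by
  cases n with
  | zero => exact IsZero.of_iso hX e.symm
  | succ n => exact cones_of_iso e hX

lemma iteratedCones_shift {P : ObjectProperty C} (k : ℤ) (hP : ∀ X, P X → P (X⟦k⟧)) {n : ℕ}
    {X : C} (hX : iteratedCones P n X) : iteratedCones P n (X⟦k⟧) := by
  induction n generalizing X with
  | zero => exact (shiftFunctor C k).map_isZero hX
  | succ n ih => exact cones_shift k hP (fun _ h => ih h) hX

lemma iteratedCones_one_of_shift {P : ObjectProperty C} {X : C} (hX : P (X⟦(-1 : ℤ)⟧)) :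
    iteratedCones P 1 X := by
  obtain ⟨O, hO⟩ := HasZeroObject.zero (C := C)
  obtain ⟨W, g, h, hT⟩ := distinguished_cocone_triangle (0 : X⟦(-1 : ℤ)⟧ ⟶ O)
  have : IsIso h := (Triangle.isZero₂_iff_isIso₃ _ hT).1 hO
  exact iteratedCones_of_iso (asIso h ≪≫ (shiftEquiv C (1 : ℤ)).counitIso.app X)
    ⟨_, _, _, g, h, hX, hO, hT⟩

/-- The octahedral axiom turns a cone of a morphism from an `n`-fold iterated cone to an object of
`P` into an `(n + 1)`-fold iterated cone. -/
lemma iteratedCones_succ_of_distTriang [IsTriangulated C] {P : ObjectProperty C}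
    (hP : ∀ (k : ℤ) X, P X → P (X⟦k⟧)) {n : ℕ} {U V Z : C} (f : U ⟶ V) (g : V ⟶ Z)
    (h : Z ⟶ U⟦(1 : ℤ)⟧) (hT : Triangle.mk f g h ∈ distTriang C) (hU : iteratedCones P n U)
    (hV : P V) : iteratedCones P (n + 1) Z := by
  induction n generalizing U V Z with
  | zero =>
    have : IsIso g := (Triangle.isZero₁_iff_isIso₂ _ hT).1 hU
    exact iteratedCones_of_iso (asIso g) (iteratedCones_one_of_shift (hP _ _ hV))
  | succ n ih =>
    obtain ⟨U₁, V₁, φ, a, b, hU₁, hV₁, hT₁⟩ := hU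
    -- U is the cone of φ : U₁ ⟶ V₁. The octahedron for V₁ ⟶ U ⟶ V exhibits Z as the cone of U₁⟦1⟧ ⟶
    -- W, and induction applies to W, the cone of V₁ ⟶ V.
    obtain ⟨W, c, d, hW⟩ := distinguished_cocone_triangle (a ≫ f)
    have o := Triangulated.someOctahedron rfl (rot_of_distTriang _ hT₁) hT hW
    exact ⟨_, _, _, _, _, hP 1 _ hU₁, ih _ c d hW hV₁ hV, o.mem⟩

lemma add_thick (X : C) (n : ℕ) : add (thick X n) ≤ thick X n := by
  match n with
  | 0 => exact add_le_of_le_add le_rfl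
  | 1 => exact add_le_of_le_add le_rfl
  | n + 2 => exact add_le_of_le_add le_rfl

lemma thick_of_iso {X : C} {n : ℕ} {Y Z : C} (e : Y ≅ Z) (hY : thick X n Y) : thick X n Z :=
  add_thick X n _ (add_of_iso e (.of _ hY))

lemma thick_of_isZero (X : C) (n : ℕ) {Y : C} (hY : IsZero Y) : thick X n Y :=
  add_thick X n _ (.zero _ hY)

lemma thick_shift {X : C} (k : ℤ) {n : ℕ} {Y : C} (hY : thick X n Y) : thick X n (Y⟦k⟧) := by
  match n with
  | 0 => exact add_shift k (fun _ h => h.elim) hY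
  | 1 => exact add_shifts_shift k hY
  | n + 2 =>
    exact add_shift k (fun _ h => cones_shift k (fun _ h' => add_shifts_shift k h')
      (fun _ h' => thick_shift k h') h) hY

/-- Only n = 0 needs an argument, as `thick X 1` is not defined by cones: there V is zero, so the
cone is U⟦1⟧. -/
lemma thick_succ_of_cones {X : C} {n : ℕ} {Y : C} (hY : cones (add (shifts X)) (thick X n) Y) :
    thick X (n + 1) Y := by
  match n with
  | 0 =>
    obtain ⟨U, V, φ, g, h, hU, hV, hT⟩ := hY
    have hV' : IsZero V := by
      have : ∀ W, add (⊥ : ObjectProperty C) W → IsZero W := by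
        intro W hW
        induction hW with
        | of _ h => exact h.elim
        | zero _ h => exact h
        | biprod _ _ _ _ h h' => exact (biprod_isZero_iff _ _).2 ⟨h, h'⟩
        | retract _ _ r _ h => exact h.of_mono r.i
      exact this V hV
    have : IsIso h := (Triangle.isZero₂_iff_isIso₃ _ hT).1 hV'
    exact add_of_iso (asIso h).symm (add_shifts_shift 1 hU)
  | n + 1 => exact .of _ hY

lemma iteratedCones_le_thick (X : C) (n : ℕ) : iteratedCones (add (shifts X)) n ≤ thick X n := by
  induction n with
  | zero => exact fun Y hY => .zero Y hY
  | succ n ih => exact fun Y hY => thick_succ_of_cones (cones_mono le_rfl ih _ hY)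

lemma thick_le_succ (X : C) (n : ℕ) : thick X n ≤ thick X (n + 1) := by
  intro Y hY
  obtain ⟨O, hO⟩ := HasZeroObject.zero (C := C)
  obtain ⟨W, g, h, hT⟩ := distinguished_cocone_triangle (0 : O ⟶ Y)
  have : IsIso g := (Triangle.isZero₁_iff_isIso₂ _ hT).1 hO
  exact thick_of_iso (asIso g).symm (thick_succ_of_cones ⟨_, _, _, g, h, .zero _ hO, hY, hT⟩)

lemma thick_monotone (X : C) : Monotone (thick X) := monotone_nat_of_le_succ (thick_le_succ X)

lemma thick_le_thick {X Y : C} (h : add (shifts X) ≤ add (shifts Y)) (n : ℕ) :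
    thick X n ≤ thick Y n := by
  match n with
  | 0 => exact le_rfl
  | 1 => exact h
  | n + 2 => exact add_mono (cones_mono h (thick_le_thick h (n + 1)))

lemma add_shifts_le_of_retract {X Y : C} (r : Retract X Y) : add (shifts X) ≤ add (shifts Y) := by
  refine add_le_of_le_add ?_
  rintro Z ⟨i, ⟨e⟩⟩
  exact add_of_iso e.symm (.retract _ _ (r.map (shiftFunctor C i))
    (.of _ ⟨i, ⟨Iso.refl _⟩⟩))

lemma thick_one_le_thick {X Y : C} {n : ℕ} (h : thick Y n X) :
    thick X 1 ≤ thick Y n := by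
  refine le_trans (add_mono ?_) (add_thick Y n)
  rintro Z ⟨i, ⟨e⟩⟩
  exact thick_of_iso e.symm (thick_shift i h)

/-- A finite sum of morphisms that factor through objects of `add P` factors through an object of
`add P`. -/
lemma exists_factorization_of_sum {P : ObjectProperty C} {ι : Type*} (s : Finset ι) {W Z : C}
    (Y : ι → C) (hY : ∀ j, add P (Y j)) (p : ∀ j, W ⟶ Y j) (i : ∀ j, Y j ⟶ Z) :
    ∃ (V : C) (a : W ⟶ V) (b : V ⟶ Z), add P V ∧ a ≫ b = ∑ j ∈ s, p j ≫ i j := by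
  classical
  induction s using Finset.induction_on with
  | empty =>
    obtain ⟨O, hO⟩ := HasZeroObject.zero (C := C)
    exact ⟨O, 0, 0, .zero _ hO, by simp⟩
  | insert j s hj ih =>
    obtain ⟨V, a, b, hV, hab⟩ := ih
    exact ⟨Y j ⊞ V, biprod.lift (p j) a, biprod.desc (i j) b, .biprod _ _ (hY j) hV, by
      rw [biprod.lift_desc, hab, Finset.sum_insert hj]⟩

/-- The identity factors through a finite sum of the Y j. This puts finitely generated projectives
into add of the ring by means of coordinates, without identifying free modules with iterated
biproducts. -/
lemma add_of_sum_eq_id {P : ObjectProperty C} {ι : Type*} [Fintype ι] {W : C}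
    (Y : ι → C) (hY : ∀ j, add P (Y j)) (p : ∀ j, W ⟶ Y j) (i : ∀ j, Y j ⟶ W)
    (h : ∑ j, p j ≫ i j = 𝟙 W) : add P W := by
  obtain ⟨V, a, b, hV, hab⟩ := exists_factorization_of_sum Finset.univ Y hY p i
  exact .retract _ _ ⟨a, b, hab.trans h⟩ hV

end Triangulated

/-! ### Composites of ghosts and the ghost lemma -/

section Ghosts

variable {D : Type*} [Category* D]

/-- The composites of `n` morphisms of `W`, the only condition for `n = 0` being vacuous. -/
def composites (W : MorphismProperty D) : ℕ → MorphismProperty D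
  | 0 => ⊤
  | n + 1 => fun X Z f => ∃ (Y : D) (g : X ⟶ Y) (h : Y ⟶ Z), composites W n g ∧ W h ∧ g ≫ h = f

lemma composites_precomp {W : MorphismProperty D} {n : ℕ} {X Y Z : D} (u : X ⟶ Y) {f : Y ⟶ Z}
    (hf : composites W n f) : composites W n (u ≫ f) := by
  induction n generalizing Z with
  | zero => trivial
  | succ n ih =>
    obtain ⟨T, g, h, hg, hh, rfl⟩ := hf
    exact ⟨T, u ≫ g, h, ih hg, hh, assoc _ _ _⟩

lemma composites_add {W : MorphismProperty D} {m n : ℕ} {X Z : D} {f : X ⟶ Z}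
    (hf : composites W (m + n) f) :
    ∃ (Y : D) (g : X ⟶ Y) (h : Y ⟶ Z), composites W m g ∧ composites W n h ∧ g ≫ h = f := by
  induction n generalizing Z with
  | zero => exact ⟨Z, f, 𝟙 Z, hf, trivial, comp_id f⟩
  | succ n ih =>
    obtain ⟨T, f', w, hf', hw, rfl⟩ := hf
    obtain ⟨Y, g, h, hg, hh, rfl⟩ := ih hf'
    exact ⟨Y, g, h ≫ w, hg, ⟨T, h, w, hh, hw, rfl⟩, (assoc _ _ _).symm⟩

/-- Bracketing m * n factors into m blocks of n allows the ghost lemma to be used twice: once for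
the ring with n, once for an object built from it with m. -/
lemma composites_mul {W : MorphismProperty D} {m n : ℕ} {X Z : D} {f : X ⟶ Z}
    (hf : composites W (m * n) f) : composites (composites W n) m f := by
  induction m generalizing Z with
  | zero => trivial
  | succ m ih =>
    rw [Nat.add_mul, one_mul] at hf
    obtain ⟨Y, g, h, hg, hh, rfl⟩ := composites_add hf
    exact ⟨Y, g, h, ih hg, hh, rfl⟩

variable [Preadditive D]

lemma eq_zero_of_composites_of_le {W : MorphismProperty D} {m n : ℕ} (hmn : m ≤ n) {X : D}
    (hX : ∀ ⦃Z : D⦄ (f : X ⟶ Z), composites W m f → f = 0) {Z : D} (f : X ⟶ Z)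
    (hf : composites W n f) : f = 0 := by
  obtain ⟨k, rfl⟩ := Nat.exists_eq_add_of_le hmn
  obtain ⟨Y, g, h, hg, -, rfl⟩ := composites_add hf
  rw [hX g hg, zero_comp]

variable [HasZeroObject D] [HasShift D ℤ] [∀ n : ℤ, (shiftFunctor D n).Additive]
  [Pretriangulated D] {C : Type*} [Category* C] [HasZeroObject C] [HasShift C ℤ] [Preadditive C]
  [∀ n : ℤ, (shiftFunctor C n).Additive] [Pretriangulated C]
  (F : C ⥤ D) [F.CommShift ℤ] [F.IsTriangulated]

/-- The objects `X` such that all morphisms from `F.obj X` that belong to `W` are zero. -/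
def killedBy (W : MorphismProperty D) : ObjectProperty C := fun X =>
  ∀ ⦃Z : D⦄ (f : F.obj X ⟶ Z), W f → f = 0

variable {F}

lemma add_le_killedBy {W : MorphismProperty D}
    (hW : ∀ ⦃X Y Z : D⦄ (u : X ⟶ Y) (f : Y ⟶ Z), W f → W (u ≫ f))
    {P : ObjectProperty C} (hP : P ≤ killedBy F W) : add P ≤ killedBy F W := by
  intro X hX
  induction hX with
  | of X hX => exact hP X hX
  | zero X hX => exact fun Z f _ => (F.map_isZero hX).eq_of_src _ _
  | biprod X Y _ _ hX hY =>
    intro Z f hf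
    rw [← id_comp f, ← F.map_id, ← biprod.total, F.map_add, F.map_comp, F.map_comp,
      Preadditive.add_comp, assoc, assoc, hX _ (hW _ _ hf), hY _ (hW _ _ hf)]
    simp
  | retract X Y r _ hY =>
    intro Z f hf
    rw [← id_comp f, ← F.map_id, ← r.retract, F.map_comp, assoc, hY _ (hW _ _ hf), comp_zero]

/-- The ghost lemma. -/
lemma thick_le_killedBy {W : MorphismProperty D}
    (hW : ∀ ⦃X Y Z : D⦄ (u : X ⟶ Y) (f : Y ⟶ Z), W f → W (u ≫ f))
    {X : C} (hX : thick X 1 ≤ killedBy F W) (n : ℕ) :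
    thick X n ≤ killedBy F (composites W n) := by
  have hC (m : ℕ) ⦃X Y Z : D⦄ (u : X ⟶ Y) (f : Y ⟶ Z) (hf : composites W m f) :
    composites W m (u ≫ f) := composites_precomp u hf
  match n with
  | 0 => exact add_le_killedBy (hC 0) (fun _ h => h.elim)
  | 1 =>
    rintro Y hY Z _ ⟨T, g, h, -, hh, rfl⟩
    exact hX Y hY _ (hW _ _ hh)
  | n + 2 =>
    refine add_le_killedBy (hC _) ?_
    rintro Y ⟨U, V, φ, a, b, hU, hV, hT⟩ Z _ ⟨T, g, h, hg, hh, rfl⟩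
    -- The first n + 1 factors vanish on V, so g factors through the shift of U, where the last
    -- factor h vanishes.
    have hg0 : F.map a ≫ g = 0 :=
      thick_le_killedBy hW hX (n + 1) V hV _ (composites_precomp _ hg)
    obtain ⟨g', rfl⟩ := Triangle.yoneda_exact₃ _ (F.map_distinguished _ hT) g hg0
    have hk : (F.commShiftIso (1 : ℤ)).hom.app U ≫ g' ≫ h = 0 :=
      hX _ (add_shifts_shift 1 hU) _ (hW _ _ (hW _ _ hh))
    have hk' : g' ≫ h = 0 := by
      rwa [Preadditive.IsIso.comp_left_eq_zero] at hk
    exact (assoc _ _ _).trans ((congrArg _ hk').trans comp_zero)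

end Ghosts

/-! ### Morphisms and cohomology of complexes of modules -/

section ModuleComplexes

variable {A : Type u} [Ring A]

open CochainComplex CochainComplex.HomComplex

/-- For K-projective K, morphisms in the derived category are the cohomology classes of the Hom
complex. -/
lemma subsingleton_hom_iff (K L : CochainComplex (ModuleCat.{u} A) ℤ) [K.IsKProjective] (n : ℤ) :
    Subsingleton (DerivedCategory.Q.obj K ⟶ (DerivedCategory.Q.obj L)⟦n⟧) ↔
      ∀ x : Cocycle K L n, x ∈ coboundaries K L n := by
  have : Localization.HasSmallLocalizedShiftedHom.{u + 1}
      (HomologicalComplex.quasiIso (ModuleCat.{u} A) (ComplexShape.up ℤ)) ℤ K L := by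
    rw [Localization.hasSmallLocalizedShiftedHom_iff _ ℤ DerivedCategory.Q]
    infer_instance
  have e : CohomologyClass K L n ≃ ShiftedHom (DerivedCategory.Q.obj K) (DerivedCategory.Q.obj L) n :=
    CohomologyClass.equivOfIsKProjective.{u + 1}.trans
      (Localization.SmallShiftedHom.equiv
        (HomologicalComplex.quasiIso (ModuleCat.{u} A) (ComplexShape.up ℤ)) DerivedCategory.Q)
  change Subsingleton (ShiftedHom (DerivedCategory.Q.obj K) (DerivedCategory.Q.obj L) n) ↔ _
  rw [← e.subsingleton_congr]
  constructor
  · intro _ x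
    exact (CohomologyClass.mk_eq_zero_iff x).1 (Subsingleton.elim _ _)
  · intro h
    refine ⟨fun x y => ?_⟩
    obtain ⟨x, rfl⟩ := x.mk_surjective
    obtain ⟨y, rfl⟩ := y.mk_surjective
    rw [← sub_eq_zero, ← CohomologyClass.mk_sub, CohomologyClass.mk_eq_zero_iff]
    exact h _

/-- Elements of a module are morphisms from A, by evaluation at 1. This form matches cocycles on a
complex concentrated in one degree. -/
lemma exactAt_iff_forall_hom (L : CochainComplex (ModuleCat.{u} A) ℤ) (n : ℤ) :
    L.ExactAt n ↔ ∀ f : ModuleCat.of A A ⟶ L.X n, f ≫ L.d n (n + 1) = 0 →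
      ∃ g : ModuleCat.of A A ⟶ L.X (n - 1), g ≫ L.d (n - 1) n = f := by
  rw [L.exactAt_iff' (n - 1) n (n + 1) (by simp) (by simp), ShortComplex.moduleCat_exact_iff]
  constructor
  · intro h f hf
    obtain ⟨y, hy⟩ := h (f (1 : A)) (congr($hf (1 : A)))
    refine ⟨ModuleCat.ofHom (LinearMap.toSpanSingleton A _ y), ?_⟩
    ext
    change L.d (n - 1) n ((1 : A) • y) = f 1
    rw [one_smul]
    exact hy
  · intro h x hx
    obtain ⟨g, hg⟩ := h (ModuleCat.ofHom (LinearMap.toSpanSingleton A _ x)) (by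
      ext
      change L.d n (n + 1) ((1 : A) • x) = 0
      rw [one_smul]
      exact hx)
    exact ⟨g 1, congr($hg (1 : A)).trans (one_smul A x)⟩

lemma subsingleton_ring_hom_iff (Y : DerivedCategory (ModuleCat.{u} A)) (n : ℤ) :
    Subsingleton ((DerivedCategory.singleFunctor (ModuleCat.{u} A) 0).obj (ModuleCat.of A A) ⟶
      Y⟦n⟧) ↔ IsZero ((DerivedCategory.homologyFunctor _ n).obj Y) := by
  let L := DerivedCategory.Q.objPreimage Y
  let e : DerivedCategory.Q.obj L ≅ Y := DerivedCategory.Q.objObjPreimageIso Y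
  have := (isStrictlyPerfect_single 0 (ModuleCat.of A A)).isKProjective
  have h₁ := (Iso.homCongr ((DerivedCategory.singleFunctorIsoCompQ (ModuleCat.{u} A) 0).app
    (ModuleCat.of A A)) ((CategoryTheory.shiftFunctor _ n).mapIso e.symm)).subsingleton_congr
  have h₂ : IsZero ((DerivedCategory.homologyFunctor _ n).obj Y) ↔ L.ExactAt n := by
    rw [HomologicalComplex.exactAt_iff_isZero_homology,
      ← ((DerivedCategory.homologyFunctor _ n).mapIso e).isZero_iff]
    exact ((DerivedCategory.homologyFunctorFactors _ n).app L).isZero_iff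
  rw [h₁, h₂, exactAt_iff_forall_hom]
  refine (subsingleton_hom_iff _ L n).trans ⟨fun h f hf => ?_, fun h x => ?_⟩
  · exact (Cocycle.fromSingleMk_mem_coboundaries_iff f (zero_add n) (n + 1) rfl hf (n - 1)
      (by simp)).1 (h _)
  · obtain ⟨f, hf, rfl⟩ := Cocycle.fromSingleMk_surjective x n (zero_add n) (n + 1) rfl
    exact (Cocycle.fromSingleMk_mem_coboundaries_iff f (zero_add n) (n + 1) rfl hf (n - 1)
      (by simp)).2 (h f hf)

lemma subsingleton_hom_single_of_isZero {K : CochainComplex (ModuleCat.{u} A) ℤ}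
    (hK : IsStrictlyPerfect K) {m : ℤ} (hm : IsZero (K.X m)) (N : ModuleCat.{u} A) :
    Subsingleton (DerivedCategory.Q.obj K ⟶
      (DerivedCategory.singleFunctor (ModuleCat.{u} A) m).obj N) := by
  have := hK.isKProjective
  have h₁ := (Iso.homCongr (Iso.refl (DerivedCategory.Q.obj K))
    ((DerivedCategory.singleFunctorIsoCompQ (ModuleCat.{u} A) m).app N ≪≫
      ((shiftFunctorZero _ ℤ).app _).symm)).subsingleton_congr
  rw [h₁]
  refine (subsingleton_hom_iff K _ 0).2 fun x => ?_
  obtain ⟨f, hf, rfl⟩ := Cocycle.toSingleMk_surjective x m (add_zero m) (m - 1) (by simp)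
  obtain rfl : f = 0 := hm.eq_of_src _ _
  rw [Cocycle.toSingleMk_zero]
  exact zero_mem _

/-- In degrees above which a strictly perfect complex is exact, the cycles form finitely generated
projective modules. -/
lemma IsStrictlyPerfect.cycles {K : CochainComplex (ModuleCat.{u} A) ℤ}
    (hK : IsStrictlyPerfect K) (b : ℤ) (hb : ∀ i, b < i → K.ExactAt i) :
    Module.Finite A (K.cycles b) ∧ Module.Projective A (K.cycles b) := by
  obtain ⟨-, c, -, hc⟩ := hK.bounded
  -- Descending induction on b, from degrees beyond the upper bound c, where the complex is zero.
  obtain ⟨n, hn⟩ : ∃ n : ℕ, c < b + n := ⟨(c - b + 1).toNat, by lia⟩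
  induction n generalizing b with
  | zero =>
    have h0 : IsZero (K.X b) := K.isZero_of_isStrictlyLE c b (by lia)
    have h1 : IsZero (K.cycles b) := h0.of_mono (K.iCycles b)
    have := ModuleCat.subsingleton_of_isZero h1
    exact ⟨inferInstance, Module.Projective.of_free⟩
  | succ n ih =>
    obtain ⟨hf, hp⟩ := ih (b + 1) (fun i hi => hb i (by lia)) (by push_cast at hn; lia)
    have hpr : Projective (K.cycles (b + 1)) := (IsProjective.iff_projective (K.cycles (b + 1))).1 hp
    have hex := (K.exactAt_iff' b (b + 1) (b + 1 + 1) (by simp) (by simp)).1 (hb (b + 1) (by lia))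
    -- Exactness in degree b + 1 makes K.X b surject onto the projective cycles there. The section s
    -- yields the projection r = 1 - d ≫ s onto the cycles in degree b.
    let s : K.cycles (b + 1) ⟶ K.X b := hex.liftFromProjective (K.iCycles (b + 1))
      (K.iCycles_d (b + 1) (b + 1 + 1))
    have hs : s ≫ K.d b (b + 1) = K.iCycles (b + 1) := hex.liftFromProjective_comp _ _
    let r : K.X b ⟶ K.cycles b := K.liftCycles (𝟙 _ - K.toCycles b (b + 1) ≫ s) (b + 1) (by simp) (by
      rw [Preadditive.sub_comp, assoc, hs, K.toCycles_i, id_comp, sub_self])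
    have hr : K.iCycles b ≫ r = 𝟙 _ := by
      rw [← cancel_mono (K.iCycles b), assoc, K.liftCycles_i, Preadditive.comp_sub, ← assoc]
      have : K.iCycles b ≫ K.toCycles b (b + 1) = 0 := by
        rw [← cancel_mono (K.iCycles (b + 1)), assoc, K.toCycles_i, K.iCycles_d, zero_comp]
      rw [this]
      simp
    have hr' : r.hom ∘ₗ (K.iCycles b).hom = LinearMap.id := congr($(hr).hom)
    have := hK.finite b
    have := hK.projective b
    exact ⟨Module.Finite.of_surjective r.hom fun x => ⟨K.iCycles b x, LinearMap.congr_fun hr' x⟩,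
      Module.Projective.of_split _ _ hr'⟩

end ModuleComplexes

/-! ### Splicing finite resolutions -/

section Resolutions

variable {A : Type u} [Ring A]

/-- The complex obtained by splicing a resolution of the left term of a short exact sequence with its
middle term. -/
noncomputable def spliceComplex {S : ShortComplex (ModuleCat.{u} A)}
    (R : ProjectiveResolution S.X₁) : ChainComplex (ModuleCat.{u} A) ℕ :=
  R.complex.augment (R.π.f 0 ≫ S.f) 
    ((assoc _ _ _).symm.trans
      ((congrArg (· ≫ S.f) R.complex_d_comp_π_f_zero).trans zero_comp))

lemma spliceComplex_exactAt_succ {S : ShortComplex (ModuleCat.{u} A)} (hS : S.ShortExact)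
    (R : ProjectiveResolution S.X₁) (n : ℕ) : (spliceComplex R).ExactAt (n + 1) := by
  rw [HomologicalComplex.exactAt_iff' _ (n + 2) (n + 1) n (by simp) (by simp)]
  cases n with
  | succ n => exact R.exact_succ n
  | zero =>
    -- The differential into degree 0 is the augmentation followed by the monomorphism `S.f`, so it
    -- has the kernel of the augmentation.
    have h := ShortComplex.exact_of_g_is_cokernel (ShortComplex.mk _ _ R.complex_d_comp_π_f_zero)
      R.isColimitCokernelCofork
    rw [ShortComplex.moduleCat_exact_iff] at h ⊢
    intro x hx
    have := hS.mono_f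
    exact h x ((ModuleCat.mono_iff_injective S.f).1 inferInstance (hx.trans (map_zero _).symm))

lemma spliceComplex_d_comp {S : ShortComplex (ModuleCat.{u} A)} (R : ProjectiveResolution S.X₁) :
    (spliceComplex R).d 1 0 ≫ S.g = 0 :=
  (assoc (R.π.f 0) S.f S.g).trans ((congrArg (R.π.f 0 ≫ ·) S.zero).trans comp_zero)

lemma exact_splice_zero {S : ShortComplex (ModuleCat.{u} A)} (hS : S.ShortExact)
    (R : ProjectiveResolution S.X₁) :
    (ShortComplex.mk ((spliceComplex R).d 1 0) S.g (spliceComplex_d_comp R)).Exact := by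
  rw [ShortComplex.moduleCat_exact_iff]
  intro x hx
  obtain ⟨y, hy⟩ := (ShortComplex.moduleCat_exact_iff _).1 hS.exact x hx
  obtain ⟨z, hz⟩ := (ModuleCat.epi_iff_surjective (R.π.f 0)).1 inferInstance y
  exact ⟨z, (congrArg S.f hz).trans hy⟩

/-- Splicing a projective resolution of the left term of a short exact sequence with projective
middle term. -/
noncomputable def spliceResolution {S : ShortComplex (ModuleCat.{u} A)} (hS : S.ShortExact)
    [Projective S.X₂] (R : ProjectiveResolution S.X₁) : ProjectiveResolution S.X₃ where
  complex := spliceComplex R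
  projective n := by
    cases n with
    | zero => exact inferInstanceAs (Projective S.X₂)
    | succ n => exact R.projective n
  π := (ChainComplex.toSingle₀Equiv _ _).symm ⟨S.g, spliceComplex_d_comp R⟩
  quasiIso := ⟨fun n => by
    cases n
    · rw [ChainComplex.quasiIsoAt₀_iff, ShortComplex.quasiIso_iff_of_zeros']
      · have := hS.epi_g
        exact ⟨exact_splice_zero hS R, this⟩
      all_goals rfl
    · rw [quasiIsoAt_iff_exactAt']
      · exact spliceComplex_exactAt_succ hS R _
      · apply ChainComplex.exactAt_succ_single_obj⟩

lemma finiteResolution_of_shortExact {S : ShortComplex (ModuleCat.{u} A)} (hS : S.ShortExact)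
    [Module.Finite A S.X₂] [Module.Projective A S.X₂] (h : finiteResolution A S.X₁) :
    finiteResolution A S.X₃ := by
  obtain ⟨R, hR, n, hn⟩ := h
  have : Projective S.X₂ := (IsProjective.iff_projective S.X₂).1 inferInstance
  refine ⟨spliceResolution hS R, fun i => ?_, n + 1, fun i hi => ?_⟩
  · cases i with
    | zero => exact inferInstanceAs (Module.Finite A S.X₂)
    | succ i => exact hR i
  · cases i with
    | zero => simp at hi
    | succ i => exact hn i (by simpa using hi)

lemma finiteResolution_of_projective (M : ModuleCat.{u} A) [Module.Finite A M] [Projective M] :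
    finiteResolution A M := by
  have h (i : ℕ) (hi : i ≠ 0) : IsZero ((ProjectiveResolution.self M).complex.X i) :=
    HomologicalComplex.isZero_single_obj_X _ _ _ _ hi
  refine ⟨ProjectiveResolution.self M, fun i => ?_, 0, fun i hi => h i hi.ne'⟩
  cases i with
  | zero => exact inferInstanceAs (Module.Finite A M)
  | succ i =>
    have := ModuleCat.subsingleton_of_isZero (h (i + 1) (by simp))
    infer_instance

/-- A finitely generated module is the cokernel of an embedding into a finite free module. -/
lemma exists_shortExact (M : ModuleCat.{u} A) [Module.Finite A M] :
    ∃ S : ShortComplex (ModuleCat.{u} A), S.ShortExact ∧ Module.Finite A S.X₂ ∧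
      Module.Projective A S.X₂ ∧ S.X₃ = M := by
  obtain ⟨n, f, hf⟩ := Module.Finite.exists_fin' A M
  let g : ModuleCat.of A (Fin n → A) ⟶ M := ModuleCat.ofHom f
  have : Epi g := (ModuleCat.epi_iff_surjective g).2 hf
  refine ⟨ShortComplex.mk (kernel.ι g) g (kernel.condition g), ?_, ?_, ?_, rfl⟩
  · exact { exact := ShortComplex.exact_kernel g, mono_f := inferInstance, epi_g := this }
  · exact inferInstanceAs (Module.Finite A (Fin n → A))
  · exact inferInstanceAs (Module.Projective A (Fin n → A))

end Resolutions

/-! ### Modules with finite resolutions are the perfect modules -/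

section PerfectModules

variable {A : Type u} [Ring A]

open DerivedCategory

/-- The shift of a module placed in degree `a`. -/
noncomputable def singleShiftIso (M : ModuleCat.{u} A) (n a a' : ℤ) (h : n + a = a') :
    ((singleFunctor (ModuleCat.{u} A) a').obj M)⟦n⟧ ≅ (singleFunctor (ModuleCat.{u} A) a).obj M :=
  ((singleFunctors (ModuleCat.{u} A)).shiftIso n a a' h).app M

lemma perf_single_of_perf_single {M : ModuleCat.{u} A} {a b : ℤ}
    (h : perf A ((singleFunctor (ModuleCat.{u} A) a).obj M)) :
    perf A ((singleFunctor (ModuleCat.{u} A) b).obj M) :=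
  (perf A).prop_of_iso (singleShiftIso M (a - b) b a (by simp))
    ((perf A).le_shift (a - b) _ h)

lemma perf_single_of_projective (P : ModuleCat.{u} A) [Module.Finite A P] [Module.Projective A P]
    (n : ℤ) : perf A ((singleFunctor (ModuleCat.{u} A) n).obj P) :=
  ⟨_, isStrictlyPerfect_single n P, ⟨(singleFunctorIsoCompQ (ModuleCat.{u} A) n).app P⟩⟩

lemma perf_of_finiteResolution {M : ModuleCat.{u} A} (h : finiteResolution A M) :
    perf A ((singleFunctor (ModuleCat.{u} A) 0).obj M) := by
  obtain ⟨R, hR, n, hn⟩ := h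
  refine ⟨R.cochainComplex, ⟨⟨-n, 0, ?_, inferInstance⟩, fun i => ?_, fun i => ?_⟩, ⟨?_⟩⟩
  · rw [CochainComplex.isStrictlyGE_iff]
    intro i hi
    exact (hn (-i).toNat (by lia)).of_iso (R.cochainComplexXIso i (-i).toNat (by lia))
  · by_cases hi : i ≤ 0
    · have := hR (-i).toNat
      exact Module.Finite.equiv (R.cochainComplexXIso i (-i).toNat (by lia)).toLinearEquiv.symm
    · have := ModuleCat.subsingleton_of_isZero
        (R.cochainComplex.isZero_of_isStrictlyLE 0 i (by lia))
      infer_instance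
  · exact (IsProjective.iff_projective _).2
      (inferInstanceAs (Projective (R.cochainComplex.X i)))
  · exact (asIso (Q.map R.π')).symm

/-- The bounds do not depend on N. This uniformity gives both finite projective dimension of perfect
modules and the constant p of a finitistic generator. -/
lemma exists_bounds_of_perf {Y : DerivedCategory (ModuleCat.{u} A)} (hY : perf A Y) :
    ∃ a b : ℤ, ∀ (m : ℤ), (m < a ∨ b < m) → ∀ (N : ModuleCat.{u} A),
      Subsingleton (Y ⟶ (singleFunctor (ModuleCat.{u} A) m).obj N) := by
  obtain ⟨K, hK, ⟨e⟩⟩ := hY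
  obtain ⟨a, b, _, _⟩ := hK.bounded
  refine ⟨a, b, fun m hm N => ?_⟩
  have : IsZero (K.X m) := by
    rcases hm with hm | hm
    · exact K.isZero_of_isStrictlyGE a m hm
    · exact K.isZero_of_isStrictlyLE b m hm
  rw [(Iso.homCongr e (Iso.refl _)).subsingleton_congr]
  exact subsingleton_hom_single_of_isZero hK this N

lemma exists_hasProjectiveDimensionLT_of_perf {M : ModuleCat.{u} A}
    (hM : perf A ((singleFunctor (ModuleCat.{u} A) 0).obj M)) :
    ∃ n : ℕ, HasProjectiveDimensionLT M n := by
  obtain ⟨a, b, h⟩ := exists_bounds_of_perf hM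
  refine ⟨(-a).toNat + 1, HasProjectiveDimensionLT.mk.{u} fun i hi N e => ?_⟩
  apply Abelian.Ext.homEquiv.injective
  have := h (-i) (.inl (by lia)) N
  rw [← (Iso.homCongr (Iso.refl _) (singleShiftIso N i (-i) 0 (by simp))).subsingleton_congr]
    at this
  exact this.elim _ _

/-- The map from the cycles in degree `b`, placed in degree `b`, to a complex. -/
noncomputable def cyclesToComplex (K : CochainComplex (ModuleCat.{u} A) ℤ) (b : ℤ) :
    (HomologicalComplex.single (ModuleCat.{u} A) (ComplexShape.up ℤ) b).obj (K.cycles b) ⟶ K :=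
  HomologicalComplex.mkHomFromSingle (K.iCycles b) (fun i _ => K.iCycles_d b i)

/-- The map is split epi on cycles in degree b, and cycles surject onto cohomology. -/
lemma epi_homologyMap_cyclesToComplex (K : CochainComplex (ModuleCat.{u} A) ℤ) (b : ℤ) :
    Epi (HomologicalComplex.homologyMap (cyclesToComplex K b) b) := by
  have h : (HomologicalComplex.singleObjCyclesSelfIso (ComplexShape.up ℤ) b (K.cycles b)).inv ≫
      HomologicalComplex.cyclesMap (cyclesToComplex K b) b = 𝟙 _ := by
    rw [← cancel_mono (K.iCycles b), assoc, HomologicalComplex.cyclesMap_i, id_comp,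
      HomologicalComplex.singleObjCyclesSelfIso_inv_iCycles_assoc, cyclesToComplex,
      HomologicalComplex.mkHomFromSingle_f, Iso.inv_hom_id_assoc]
  have : Epi (HomologicalComplex.cyclesMap (cyclesToComplex K b) b) :=
    (SplitEpi.mk _ h).epi
  have h2 := HomologicalComplex.homologyπ_naturality (cyclesToComplex K b) b
  exact epi_of_epi_fac h2

/-- A perfect complex with cohomology in degrees `≤ b` receives a morphism from a finitely generated
projective module placed in degree `b` that is surjective on cohomology in degree `b`. -/
lemma exists_epi_homology {Y : DerivedCategory (ModuleCat.{u} A)} (hY : perf A Y) (b : ℤ)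
    [hb : Y.IsLE b] : ∃ (P : ModuleCat.{u} A) (_ : Module.Finite A P) (_ : Module.Projective A P)
      (φ : (singleFunctor (ModuleCat.{u} A) b).obj P ⟶ Y), Epi ((homologyFunctor _ b).map φ) := by
  obtain ⟨K, hK, ⟨e⟩⟩ := hY
  have hKb : K.IsLE b := by
    rw [← isLE_Q_obj_iff]
    exact TStructure.t.isLE_of_iso e b
  obtain ⟨hf, hp⟩ := hK.cycles b (fun i hi => K.exactAt_of_isLE b i hi)
  refine ⟨K.cycles b, hf, hp, Q.map (cyclesToComplex K b) ≫ e.inv, ?_⟩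
  have : Epi ((homologyFunctor _ b).map (Q.map (cyclesToComplex K b))) := by
    have h := homologyFunctorFactors_hom_naturality (cyclesToComplex K b) b
    have : Epi ((homologyFunctor _ b).map (Q.map (cyclesToComplex K b)) ≫
        (homologyFunctorFactors _ b).hom.app K) := by
      rw [h]
      exact epi_comp' inferInstance (epi_homologyMap_cyclesToComplex K b)
    exact (epi_comp_iff_of_isIso _ _).1 this
  have h : Epi ((homologyFunctor _ b).map (Q.map (cyclesToComplex K b) ≫ e.inv)) := by
    rw [Functor.map_comp]
    exact epi_comp' this inferInstance
  exact h

lemma finite_of_perf_single {M : ModuleCat.{u} A} {b : ℤ}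
    (hM : perf A ((singleFunctor (ModuleCat.{u} A) b).obj M)) : Module.Finite A M := by
  obtain ⟨P, _, _, φ, hφ⟩ := exists_epi_homology hM b
  let f : P ⟶ M := (singleFunctorCompHomologyFunctorIso _ b).inv.app P ≫
    (homologyFunctor _ b).map φ ≫ (singleFunctorCompHomologyFunctorIso _ b).hom.app M
  have : Epi f := by
    dsimp only [f]
    infer_instance
  exact Module.Finite.of_surjective f.hom ((ModuleCat.epi_iff_surjective f).1 this)

lemma perf_single_X₁ {S : ShortComplex (ModuleCat.{u} A)} (hS : S.ShortExact)
    [Module.Finite A S.X₂] [Module.Projective A S.X₂]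
    (h : perf A ((singleFunctor (ModuleCat.{u} A) 0).obj S.X₃)) :
    perf A ((singleFunctor (ModuleCat.{u} A) 0).obj S.X₁) :=
  (perf A).ext_of_isTriangulatedClosed₁ _ hS.singleTriangle_distinguished
    (perf_single_of_projective S.X₂ 0) h

/-- Induction along syzygies: the kernel of a finite free cover is again perfect, hence finitely
generated, and has smaller projective dimension. -/
lemma finiteResolution_of_perf_of_hasProjectiveDimensionLT (n : ℕ) {M : ModuleCat.{u} A}
    (hM : perf A ((singleFunctor (ModuleCat.{u} A) 0).obj M)) (hn : HasProjectiveDimensionLT M (n + 1)) :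
    finiteResolution A M := by
  have := finite_of_perf_single hM
  induction n generalizing M with
  | zero =>
    have : Projective M := projective_iff_hasProjectiveDimensionLT_one.2 hn
    exact finiteResolution_of_projective M
  | succ n ih =>
    obtain ⟨S, hS, _, _, rfl⟩ := exists_shortExact M
    have : Projective S.X₂ := (IsProjective.iff_projective S.X₂).1 inferInstance
    have h := perf_single_X₁ hS hM
    exact finiteResolution_of_shortExact hS (ih h
      ((hS.hasProjectiveDimensionLT_X₃_iff n this).1 hn) (finite_of_perf_single h))

lemma finiteResolution_iff_perf (M : ModuleCat.{u} A) :
    finiteResolution A M ↔ perf A ((singleFunctor (ModuleCat.{u} A) 0).obj M) := by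
  refine ⟨perf_of_finiteResolution, fun h => ?_⟩
  obtain ⟨n, hn⟩ := exists_hasProjectiveDimensionLT_of_perf h
  exact finiteResolution_of_perf_of_hasProjectiveDimensionLT n h
    (hasProjectiveDimensionLT_of_ge M n (n + 1) (by simp))

end PerfectModules

/-! ### Ext classes as composites of ghosts -/

section RingGhosts

open DerivedCategory

/-- Morphisms between shifts correspond to morphisms to a single shift. -/
noncomputable def shiftHomEquiv {C : Type*} [Category* C] [HasShift C ℤ] (X Y : C) (i k n : ℤ)
    (h : n + i = k) : (X⟦i⟧ ⟶ Y⟦k⟧) ≃ (X ⟶ Y⟦n⟧) :=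
  (Iso.homCongr (Iso.refl (X⟦i⟧)) ((shiftFunctorAdd' C n i k h).app Y)).trans
    (Functor.FullyFaithful.ofFullyFaithful (shiftFunctor C i)).homEquiv.symm

variable (A : Type u) [Ring A]

/-- The morphisms in the derived category that induce zero on cohomology, tested by morphisms from
the shifts of the ring. -/
def ghost : MorphismProperty (DerivedCategory (ModuleCat.{u} A)) := fun X _ f =>
  ∀ (i : ℤ) (g : ((singleFunctor (ModuleCat.{u} A) 0).obj (ModuleCat.of A A))⟦i⟧ ⟶ X), g ≫ f = 0

variable {A}

lemma ghost_precomp ⦃X Y Z : DerivedCategory (ModuleCat.{u} A)⦄ (u : X ⟶ Y) (f : Y ⟶ Z)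
    (hf : ghost A f) : ghost A (u ≫ f) := fun i g => by
  rw [← assoc]
  exact hf i _

lemma isZero_homology_single (M : ModuleCat.{u} A) (a n : ℤ) (h : n ≠ a) :
    IsZero ((homologyFunctor (ModuleCat.{u} A) n).obj
      ((singleFunctor (ModuleCat.{u} A) a).obj M)) := by
  rcases lt_or_gt_of_ne h with h | h
  · exact isZero_of_isGE _ a n h
  · exact isZero_of_isLE _ a n h

/-- The cohomology of the two sides sits in different degrees: a test map from the i-th shift of A
is zero if i ≠ k, and for i = k the composite lies in a group that vanishes with H^1(N). -/
lemma ghost_single_hom (M N : ModuleCat.{u} A) (k l : ℤ) (h : k + 1 = l)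
    (f : ((singleFunctor (ModuleCat.{u} A) 0).obj M)⟦k⟧ ⟶
      ((singleFunctor (ModuleCat.{u} A) 0).obj N)⟦l⟧) : ghost A f := by
  intro i g
  by_cases hi : k = i
  · have := (shiftHomEquiv _ _ i l 1 (by lia)).subsingleton_congr.2 ((subsingleton_ring_hom_iff _ 1).2
      (isZero_homology_single N 0 1 one_ne_zero))
    exact this.elim _ _
  · have := (shiftHomEquiv _ _ i k (k - i) (by lia)).subsingleton_congr.2
      ((subsingleton_ring_hom_iff _ (k - i)).2
      (isZero_homology_single M 0 (k - i) (by lia)))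
    rw [this.elim g 0, zero_comp]

lemma composites_ghost_hom (n : ℕ) (M N : ModuleCat.{u} A) (e : Abelian.Ext.{u} M N n) :
    composites (ghost A) n e.hom := by
  induction n generalizing N with
  | zero => trivial
  | succ n ih =>
    let S := ShortComplex.mk (Injective.ι N) (cokernel.π (Injective.ι N)) (cokernel.condition _)
    have hS : S.ShortExact :=
      { exact := ShortComplex.exact_cokernel _, mono_f := inferInstanceAs (Mono (Injective.ι N)),
        epi_g := inferInstanceAs (Epi (cokernel.π _)) }
    have : Injective S.X₂ := inferInstanceAs (Injective (Injective.under N))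
    -- Dimension shifting: e dies in the injective module, so it is a class x of degree n into the
    -- cokernel followed by the extension class of S, which is a ghost.
    obtain ⟨x, hx⟩ := Abelian.Ext.covariant_sequence_exact₁ M hS e
      (Abelian.Ext.eq_zero_of_injective _) rfl
    rw [← hx, Abelian.Ext.comp_hom]
    exact ⟨_, x.hom, _, ih _ x, ghost_single_hom _ _ n (n + 1 : ℕ) (by simp) _, rfl⟩

lemma thick_ringPerf_le_killedBy_ghost (n : ℕ) :
    thick (ringPerf A) n ≤ killedBy (perf A).ι (composites (ghost A) n) := by
  refine thick_le_killedBy ghost_precomp (add_le_killedBy ghost_precomp ?_) n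
  rintro Y ⟨i, ⟨e⟩⟩ Z f hf
  have e' := (perf A).ι.mapIso e ≪≫ ((perf A).ι.commShiftIso i).app (ringPerf A)
  rw [← cancel_epi e'.inv, comp_zero]
  exact hf i _

/-- If `X` is built from `A` in `q` steps, then modules built from `X` in `p` steps have projective
dimension less than `p * q`. -/
lemma hasProjectiveDimensionLT_of_thick {X : Perf A} {p q : ℕ}
    (hX : thick X 1 ≤ thick (ringPerf A) q) {M : ModuleCat.{u} A}
    (h : perf A ((singleFunctor (ModuleCat.{u} A) 0).obj M)) (hM : thick X p ⟨_, h⟩) :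
    HasProjectiveDimensionLT M (p * q) := by
  have hk := thick_le_killedBy (W := composites (ghost A) q)
    (fun _ _ _ u _ hf => composites_precomp u hf)
    (hX.trans (thick_ringPerf_le_killedBy_ghost q)) p _ hM
  refine HasProjectiveDimensionLT.mk.{u} fun i hi N e => ?_
  apply Abelian.Ext.ext
  rw [Abelian.Ext.zero_hom]
  exact eq_zero_of_composites_of_le hi (fun Z f hf => hk f (composites_mul hf)) _
    (composites_ghost_hom i M N e)

end RingGhosts

/-! ### Building perfect complexes from the ring -/

section Perf

open DerivedCategory

variable {A : Type u} [Ring A]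

/-- The shift of perfect complexes is the shift in the derived category. -/
noncomputable def perfShiftIso (Y : Perf A) (n : ℤ) : (Y⟦n⟧).obj ≅ Y.obj⟦n⟧ :=
  ((perf A).ι.commShiftIso n).app Y

lemma add_shifts_ringPerf_of_projective (P : ModuleCat.{u} A) [Module.Finite A P]
    [Module.Projective A P] (n : ℤ) (h : perf A ((singleFunctor (ModuleCat.{u} A) n).obj P)) :
    add (shifts (ringPerf A)) ⟨_, h⟩ := by
  have h0 : add (shifts (ringPerf A)) ⟨_, perf_single_of_projective P 0⟩ := by
    obtain ⟨k, f, hf⟩ := Module.Finite.exists_fin' A P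
    obtain ⟨s, hs⟩ := Module.projective_lifting_property f LinearMap.id hf
    let p (j : Fin k) : P ⟶ ModuleCat.of A A := ModuleCat.ofHom (LinearMap.proj j ∘ₗ s)
    let i (j : Fin k) : ModuleCat.of A A ⟶ P :=
      ModuleCat.ofHom (f ∘ₗ LinearMap.single A (fun _ => A) j)
    have hpi : ∑ j, p j ≫ i j = 𝟙 P := by
      ext x
      have : f (∑ j, Pi.single j (s x j)) = x := by
        rw [Finset.univ_sum_single]
        exact LinearMap.congr_fun hs x
      rw [map_sum] at this
      simpa [p, i, ModuleCat.hom_sum] using this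
    refine add_of_sum_eq_id (fun _ : Fin k => ringPerf A) (fun _ => .of _ (shifts_self _))
      (fun j => (perf A).fullyFaithfulι.preimage ((singleFunctor _ 0).map (p j)))
      (fun j => (perf A).fullyFaithfulι.preimage ((singleFunctor _ 0).map (i j))) ?_
    apply (perf A).ι.map_injective
    rw [Functor.map_sum]
    have h2 := congr((singleFunctor (ModuleCat.{u} A) 0).map $hpi)
    rw [Functor.map_sum] at h2
    simp only [Functor.map_comp] at h2
    exact h2.trans ((singleFunctor (ModuleCat.{u} A) 0).map_id P)
  exact add_of_iso ((perf A).isoMk (perfShiftIso _ (-n) ≪≫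
    singleShiftIso P (-n) n 0 (by simp))) (add_shifts_shift (-n) h0)

lemma iteratedCones_of_distTriang {T : Triangle (DerivedCategory (ModuleCat.{u} A))}
    (hT : T ∈ distTriang _) (h₁ : perf A T.obj₁) (h₂ : perf A T.obj₂) (h₃ : perf A T.obj₃) {n : ℕ}
    (hn : iteratedCones (add (shifts (ringPerf A))) n ⟨_, h₁⟩)
    (hV : add (shifts (ringPerf A)) ⟨_, h₂⟩) :
    iteratedCones (add (shifts (ringPerf A))) (n + 1) ⟨_, h₃⟩ := by
  let f : (⟨_, h₁⟩ : Perf A) ⟶ ⟨_, h₂⟩ := ObjectProperty.homMk T.mor₁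
  obtain ⟨W, g, h, hW⟩ := distinguished_cocone_triangle f
  refine iteratedCones_of_iso ((perf A).isoMk ?_)
    (iteratedCones_succ_of_distTriang (fun k _ hX => add_shifts_shift k hX) f g h hW hn hV)
  exact Triangle.π₃.mapIso (isoTriangleOfIso₁₂ _ T ((perf A).ι.map_distinguished _ hW) hT
    (Iso.refl _) (Iso.refl _) ((comp_id _).trans (id_comp _).symm))

lemma iteratedCones_single (d : ℕ) (M : ModuleCat.{u} A) (hd : HasProjectiveDimensionLT M (d + 1))
    (h : perf A ((singleFunctor (ModuleCat.{u} A) 0).obj M)) :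
    iteratedCones (add (shifts (ringPerf A))) (d + 1) ⟨_, h⟩ := by
  have := finite_of_perf_single h
  induction d generalizing M with
  | zero =>
    have : Projective M := projective_iff_hasProjectiveDimensionLT_one.2 hd
    have : Module.Projective A M := (IsProjective.iff_projective M).2 this
    exact iteratedCones_one_of_shift (add_shifts_shift _ (add_shifts_ringPerf_of_projective M 0 h))
  | succ d ih =>
    obtain ⟨S, hS, _, _, rfl⟩ := exists_shortExact M
    have : Projective S.X₂ := (IsProjective.iff_projective S.X₂).1 inferInstance
    have h₁ := perf_single_X₁ hS h
    exact iteratedCones_of_distTriang hS.singleTriangle_distinguished h₁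
      (perf_single_of_projective S.X₂ 0) h
      (ih S.X₁ ((hS.hasProjectiveDimensionLT_X₃_iff d this).1 hd) h₁ (finite_of_perf_single h₁))
      (add_shifts_ringPerf_of_projective S.X₂ 0 _)

/-- A perfect complex with cohomology in degrees `a, …, a + n` is obtained by cones from `n`
finitely generated projective modules and a module in `𝒫(A)`. -/
lemma exists_finiteResolution_forall_iteratedCones (n : ℕ) (a b : ℤ) (hab : a + n = b)
    (Y : DerivedCategory (ModuleCat.{u} A)) (hY : perf A Y) [Y.IsGE a] [Y.IsLE b] :
    ∃ M : ModuleCat.{u} A, finiteResolution A M ∧ ∀ d : ℕ, HasProjectiveDimensionLT M (d + 1) →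
      iteratedCones (add (shifts (ringPerf A))) (d + 1 + n) ⟨Y, hY⟩ := by
  induction n generalizing b Y with
  | zero =>
    obtain rfl : a = b := by simpa using hab
    obtain ⟨M, ⟨e⟩⟩ := exists_iso_singleFunctor_obj_of_isGE_of_isLE Y a
    have hM : perf A ((singleFunctor (ModuleCat.{u} A) 0).obj M) :=
      perf_single_of_perf_single ((perf A).prop_of_iso e hY)
    refine ⟨M, (finiteResolution_iff_perf M).2 hM, fun d hd => ?_⟩
    refine iteratedCones_of_iso ((perf A).isoMk (perfShiftIso _ (-a) ≪≫
      singleShiftIso M (-a) a 0 (by simp) ≪≫ e.symm))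
      (iteratedCones_shift (-a) (fun _ hX => add_shifts_shift (-a) hX) (iteratedCones_single d M hd hM))
  | succ n ih =>
    obtain ⟨P, _, _, φ, hφ⟩ := exists_epi_homology hY b
    have hP := perf_single_of_projective P b
    obtain ⟨Y', g, h, hT⟩ := distinguished_cocone_triangle φ
    have hY' : perf A Y' := (perf A).ext_of_isTriangulatedClosed₃ _ hT hP hY
    -- By the long exact sequence, H^i(Y') lies between H^i(Y) and H^(i+1) of P in degree b, which
    -- is nonzero at most for i + 1 = b.
    have hz (i : ℤ) (h₁ : i + 1 ≠ b) (h₂ : (homologyFunctor (ModuleCat.{u} A) i).map g = 0) :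
        IsZero ((homologyFunctor (ModuleCat.{u} A) i).obj Y') :=
      (HomologySequence.exact₃ _ hT i (i + 1)).isZero_X₂ h₂
        ((isZero_homology_single P b (i + 1) h₁).eq_of_tgt _ _)
    have : Y'.IsGE a := by
      rw [isGE_iff]
      intro i hi
      -- Here a < b, so i < a excludes i + 1 = b: the lower bound survives.
      exact hz i (by lia) ((isZero_of_isGE Y a i hi).eq_of_src _ _)
    have : Y'.IsLE (b - 1) := by
      rw [isLE_iff]
      intro i hi
      refine hz i (by lia) ?_
      by_cases hib : i = b
      · subst hib
        exact (HomologySequence.epi_homologyMap_mor₁_iff _ hT i).1 hφ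
      · exact (isZero_of_isLE Y b i (by lia)).eq_of_src _ _
    obtain ⟨M, hM, h⟩ := ih (b - 1) (by push_cast at hab; lia) Y' hY'
    refine ⟨M, hM, fun d hd => ?_⟩
    -- Rotated back, Y is the cone of Y'⟦-1⟧ ⟶ P, one cone more than Y'.
    exact iteratedCones_of_distTriang (inv_rot_of_distTriang _ hT)
      ((perf A).le_shift (-1) _ hY') hP hY
      (iteratedCones_of_iso ((perf A).isoMk (perfShiftIso ⟨Y', hY'⟩ (-1)))
        (iteratedCones_shift (-1) (fun _ hX => add_shifts_shift (-1) hX) (h d hd)))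
      (add_shifts_ringPerf_of_projective P b hP)

end Perf

/-! ### Sums of consecutive shifts -/

section SumShifts

variable {C : Type*} [Category* C] [Preadditive C]

lemma nontrivial_biprod_hom_iff [HasBinaryBiproducts C] {U V Z : C} :
    Nontrivial (U ⊞ V ⟶ Z) ↔ Nontrivial (U ⟶ Z) ∨ Nontrivial (V ⟶ Z) := by
  simp only [← not_subsingleton_iff_nontrivial, ← not_and_or, not_iff_not]
  constructor
  · intro h
    refine ⟨⟨fun f g => ?_⟩, ⟨fun f g => ?_⟩⟩
    · rw [← biprod.inl_desc f 0, h.elim (biprod.desc f 0) (biprod.desc g 0), biprod.inl_desc]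
    · rw [← biprod.inr_desc 0 f, h.elim (biprod.desc 0 f) (biprod.desc 0 g), biprod.inr_desc]
  · rintro ⟨h₁, h₂⟩
    exact ⟨fun f g => biprod.hom_ext' _ _ (h₁.elim _ _) (h₂.elim _ _)⟩

lemma nontrivial_hom_biprod [HasBinaryBiproducts C] {U V Z : C} (h : Nontrivial (Z ⟶ U ⊞ V)) :
    Nontrivial (Z ⟶ U) ∨ Nontrivial (Z ⟶ V) := by
  by_contra! hc
  exact not_subsingleton_iff_nontrivial.2 h
    ⟨fun f g => biprod.hom_ext _ _ (hc.1.elim _ _) (hc.2.elim _ _)⟩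

variable [HasZeroObject C] [HasShift C ℤ] [∀ n : ℤ, (shiftFunctor C n).Additive] [Pretriangulated C]

/-- The object `X ⊞ X⟦1⟧ ⊞ ⋯ ⊞ X⟦k⟧`. -/
noncomputable def sumShifts (X : C) : ℕ → C
  | 0 => X
  | k + 1 => sumShifts X k ⊞ X⟦((k + 1 : ℕ) : ℤ)⟧

/-- The summand of `sumShifts X k` in shift zero. -/
noncomputable def retractSumShifts (X : C) : (k : ℕ) → Retract X (sumShifts X k)
  | 0 => Retract.refl X
  | k + 1 => (retractSumShifts X k).trans ⟨biprod.inl, biprod.fst, biprod.inl_fst⟩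

lemma thick_sumShifts (X : C) (k n : ℕ) : thick X n ≤ thick (sumShifts X k) n :=
  thick_le_thick (add_shifts_le_of_retract (retractSumShifts X k)) n

lemma nontrivial_sumShifts_hom_iff (X Y : C) (k : ℕ) (i : ℤ) :
    Nontrivial (sumShifts X k ⟶ Y⟦i⟧) ↔ ∃ j : ℕ, j ≤ k ∧ Nontrivial (X ⟶ Y⟦i - j⟧) := by
  induction k with
  | zero => simp [sumShifts]
  | succ k ih =>
    rw [sumShifts, nontrivial_biprod_hom_iff, ih,
      (shiftHomEquiv X Y ((k + 1 : ℕ) : ℤ) i (i - (k + 1 : ℕ)) (by simp)).nontrivial_congr]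
    constructor
    · rintro (⟨j, hj, h⟩ | h)
      · exact ⟨j, by lia, h⟩
      · exact ⟨k + 1, le_rfl, h⟩
    · rintro ⟨j, hj, h⟩
      rcases Nat.le_succ_iff.1 hj with hj | rfl
      · exact .inl ⟨j, hj, h⟩
      · exact .inr h

lemma exists_of_nontrivial_hom_sumShifts (X Y : C) (k : ℕ) (n : ℤ)
    (h : Nontrivial (Y ⟶ (sumShifts X k)⟦n⟧)) :
    ∃ j : ℕ, j ≤ k ∧ Nontrivial (Y ⟶ X⟦j + n⟧) := by
  induction k with
  | zero => exact ⟨0, le_rfl, by simpa [sumShifts] using h⟩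
  | succ k ih =>
    have := preservesBinaryBiproducts_of_preservesBiproducts (shiftFunctor C n)
    rw [sumShifts, (Iso.homCongr (Iso.refl Y)
      ((shiftFunctor C n).mapBiprod _ _)).nontrivial_congr] at h
    rcases nontrivial_hom_biprod h with h | h
    · obtain ⟨j, hj, h⟩ := ih h
      exact ⟨j, by lia, h⟩
    · exact ⟨k + 1, le_rfl, (Iso.homCongr (Iso.refl Y)
        ((shiftFunctorAdd C ((k + 1 : ℕ) : ℤ) n).app X)).nontrivial_congr.2 h⟩

end SumShifts

/-! ### Comparison of the two finitistic dimensions -/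

section FinDim

open DerivedCategory

variable {A : Type u} [Ring A]

lemma ringFinDim_le_iff (k : ℕ) :
    ringFinDim A ≤ k ↔ ∀ M, finiteResolution A M → HasProjectiveDimensionLT M (k + 1) := by
  rw [ringFinDim, iSup₂_le_iff]
  refine forall₂_congr fun M _ => ?_
  refine Iff.trans ?_ (projectiveDimension_le_iff M k)
  -- In the case `⊥` of the zero module, the default value 0 makes both inequalities true.
  generalize projectiveDimension M = x
  induction x with
  | bot => simp
  | coe x => exact (WithBot.coe_le_coe (a := x) (b := (k : ℕ∞))).symm

lemma exists_isGE_isLE (Y : Perf A) : ∃ a b : ℤ, Y.obj.IsGE a ∧ Y.obj.IsLE b := by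
  obtain ⟨K, hK, ⟨e⟩⟩ := Y.property
  obtain ⟨a, b, _, _⟩ := hK.bounded
  exact ⟨a, b, TStructure.t.isGE_of_iso e.symm a, TStructure.t.isLE_of_iso e.symm b⟩

lemma nontrivial_ringPerf_hom_iff (Y : Perf A) (i : ℤ) :
    Nontrivial (ringPerf A ⟶ Y⟦i⟧) ↔
      ¬ IsZero ((homologyFunctor (ModuleCat.{u} A) i).obj Y.obj) := by
  rw [← not_subsingleton_iff_nontrivial, not_iff_not, ← subsingleton_ring_hom_iff]
  exact ((perf A).fullyFaithfulι.homEquiv.trans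
    (Iso.homCongr (Iso.refl _) (perfShiftIso Y i))).subsingleton_congr

lemma isZero_of_forall_homology (Y : Perf A)
    (h : ∀ i, IsZero ((homologyFunctor (ModuleCat.{u} A) i).obj Y.obj)) : IsZero Y := by
  have : Y.obj.IsGE 1 := (isGE_iff _ _).2 fun i _ => h i
  have : Y.obj.IsLE 0 := (isLE_iff _ _).2 fun i _ => h i
  rw [IsZero.iff_id_eq_zero]
  apply (perf A).ι.map_injective
  exact TStructure.t.zero (X := Y.obj) (Y := Y.obj) _ 0 1 (by simp)

lemma exists_thick_ringPerf (Y : Perf A) : ∃ q, thick (ringPerf A) q Y := by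
  obtain ⟨a, b, _, hb⟩ := exists_isGE_isLE Y
  -- The truncation `toNat` allows for b < a.
  have : Y.obj.IsLE (a + (b - a).toNat) := (isLE_iff _ _).2 fun i hi =>
    isZero_of_isLE Y.obj b i (by lia)
  obtain ⟨M, hM, h⟩ :=
    exists_finiteResolution_forall_iteratedCones (b - a).toNat a _ rfl Y.obj Y.property
  obtain ⟨d, hd⟩ := exists_hasProjectiveDimensionLT_of_perf (perf_of_finiteResolution hM)
  exact ⟨_, iteratedCones_le_thick _ _ _ (h d (hasProjectiveDimensionLT_of_ge M d (d + 1) (by simp)))⟩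

/-- A nonzero object of hom^1(A) has cohomology in a single degree, so it is a shifted module.
Morphisms from X to its shifts then live in a window of b - a + 1 degrees that depends on X only. -/
lemma exists_hom_ringPerf_one_le (X : Perf A) : ∃ p, hom (ringPerf A) 1 ≤ hom X p := by
  obtain ⟨a, b, h⟩ := exists_bounds_of_perf X.property
  refine ⟨(b - a).toNat + 1, fun Y hY i j hi hj => ?_⟩
  by_cases hz : ∀ c, IsZero ((homologyFunctor (ModuleCat.{u} A) c).obj Y.obj)
  · have hY0 := (shiftFunctor (Perf A) i).map_isZero (isZero_of_forall_homology Y hz)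
    obtain ⟨f, g, hfg⟩ := hi
    exact (hfg (hY0.eq_of_tgt f g)).elim
  · push Not at hz
    obtain ⟨c, hc⟩ := hz
    have hc' (k : ℤ) (hk : k ≠ c) :
        IsZero ((homologyFunctor (ModuleCat.{u} A) k).obj Y.obj) := by
      by_contra hk'
      have := hY k c ((nontrivial_ringPerf_hom_iff Y k).2 hk')
        ((nontrivial_ringPerf_hom_iff Y c).2 hc)
      rw [abs_lt] at this
      lia
    have : Y.obj.IsGE c := (isGE_iff _ _).2 fun k hk => hc' k (by lia)
    have : Y.obj.IsLE c := (isLE_iff _ _).2 fun k hk => hc' k (by lia)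
    obtain ⟨N, ⟨e⟩⟩ := exists_iso_singleFunctor_obj_of_isGE_of_isLE Y.obj c
    have hb (k : ℤ) (hk : Nontrivial (X ⟶ Y⟦k⟧)) : a ≤ c - k ∧ c - k ≤ b := by
      by_contra hc
      exact not_subsingleton_iff_nontrivial.2 hk (((perf A).fullyFaithfulι.homEquiv.trans
        (Iso.homCongr (Iso.refl X.obj) (perfShiftIso Y k ≪≫ (shiftFunctor _ k).mapIso e ≪≫
          singleShiftIso N k (c - k) c (by simp)))).subsingleton_congr.2 (h (c - k) (by lia) N))
    have := hb i hi
    have := hb j hj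
    rw [abs_lt]
    lia

/-- Modules in `𝒫(A)` have projective dimension less than `p * q` if a finitistic generator is
comparable to the ring with constants `p` and `q`. -/
lemma IsFinitisticGenerator.hasProjectiveDimensionLT {X : Perf A} (hX : IsFinitisticGenerator X)
    {p q : ℕ} (hp : hom (ringPerf A) 1 ≤ hom X p) (hq : thick X 1 ≤ thick (ringPerf A) q)
    {M : ModuleCat.{u} A} (hM : finiteResolution A M) : HasProjectiveDimensionLT M (p * q) := by
  have hM' := perf_of_finiteResolution hM
  refine hasProjectiveDimensionLT_of_thick hq hM' (hX.hom_le_thick p _ (hp _ fun i j hi hj => ?_))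
  rw [nontrivial_ringPerf_hom_iff] at hi hj
  obtain rfl : i = 0 := by_contra fun h => hi (isZero_homology_single M 0 i h)
  obtain rfl : j = 0 := by_contra fun h => hj (isZero_homology_single M 0 j h)
  simp

lemma isFinitisticGenerator_sumShifts_ringPerf (d : ℕ)
    (hd : ∀ M, finiteResolution A M → HasProjectiveDimensionLT M (d + 1)) :
    IsFinitisticGenerator (sumShifts (ringPerf A) d) where
  homologicallyFinite Y := by
    obtain ⟨a, b, _, _⟩ := exists_isGE_isLE Y
    have h (i : ℤ) (hi : Nontrivial (sumShifts (ringPerf A) d ⟶ Y⟦i⟧)) : a ≤ i ∧ i ≤ b + d := by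
      obtain ⟨j, hj, h⟩ := (nontrivial_sumShifts_hom_iff _ _ _ _).1 hi
      rw [nontrivial_ringPerf_hom_iff] at h
      constructor
      · by_contra hia
        exact h (isZero_of_isGE Y.obj a _ (by lia))
      · by_contra hib
        exact h (isZero_of_isLE Y.obj b _ (by lia))
    refine ⟨(b + d - a).toNat + 1, fun i j hi hj => ?_⟩
    have := h i hi
    have := h j hj
    rw [abs_lt]
    lia
  hom_le_thick p Y hY := by
    by_cases hz : ∀ c, IsZero ((homologyFunctor (ModuleCat.{u} A) c).obj Y.obj)
    · exact thick_of_isZero _ _ (isZero_of_forall_homology Y hz)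
    · push Not at hz
      obtain ⟨a', b', _, _⟩ := exists_isGE_isLE Y
      obtain ⟨a, ha, ha'⟩ := Int.exists_least_of_bdd
        (P := fun c => ¬ IsZero ((homologyFunctor (ModuleCat.{u} A) c).obj Y.obj))
        ⟨a', fun c hc => by_contra fun h => hc (isZero_of_isGE Y.obj a' c (by lia))⟩ hz
      obtain ⟨b, hb, hb'⟩ := Int.exists_greatest_of_bdd
        (P := fun c => ¬ IsZero ((homologyFunctor (ModuleCat.{u} A) c).obj Y.obj))
        ⟨b', fun c hc => by_contra fun h => hc (isZero_of_isLE Y.obj b' c (by lia))⟩ hz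
      have : Y.obj.IsGE a := (isGE_iff _ _).2 fun i hi => by_contra fun h => by
        have := ha' i h
        lia
      have : Y.obj.IsLE b := (isLE_iff _ _).2 fun i hi => by_contra fun h => by
        have := hb' i h
        lia
      have hab := ha' b hb
      obtain ⟨M, hM, h⟩ := exists_finiteResolution_forall_iteratedCones (b - a).toNat a b
        (by lia) Y.obj Y.property
      -- The summand A detects H^a(Y) in degree a, and the summand Σ^d A detects H^b(Y) in degree b
      -- + d. Hence b + d - a < p, which leaves room for the d + 1 + (b - a) cones.
      have hlt := hY a (b + d)
        ((nontrivial_sumShifts_hom_iff _ _ _ _).2 ⟨0, by simp, by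
          simpa using (nontrivial_ringPerf_hom_iff Y a).2 ha⟩)
        ((nontrivial_sumShifts_hom_iff _ _ _ _).2 ⟨d, le_rfl, by
          simpa using (nontrivial_ringPerf_hom_iff Y b).2 hb⟩)
      exact thick_sumShifts _ _ _ _ (thick_monotone _ (by grind) _
        (iteratedCones_le_thick _ _ _ (h d (hd M hM))))

/-- A nonzero morphism from the j-th summand to the n-th shift of the k-th forces n = j - k, with 0
≤ j, k ≤ d. -/
lemma amp_sumShifts_ringPerf_le (d : ℕ) : amp (sumShifts (ringPerf A) d) ≤ d := by
  refine iSup₂_le fun n hn => ?_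
  obtain ⟨j, hj, h⟩ := (nontrivial_sumShifts_hom_iff _ _ _ _).1 hn
  obtain ⟨k, hk, h⟩ := exists_of_nontrivial_hom_sumShifts _ _ _ _ h
  rw [nontrivial_ringPerf_hom_iff] at h
  have h0 : (k : ℤ) + (n - j) = 0 :=
    by_contra fun h0 => h (isZero_homology_single (ModuleCat.of A A) 0 _ h0)
  exact_mod_cast (by lia : n.natAbs ≤ d)

variable (A) in
lemma triangulatedFinDim_le_ringFinDim : triangulatedFinDim (Perf A) ≤ ringFinDim A := by
  cases h : ringFinDim A with
  | top => exact le_top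
  | coe d =>
    exact (iInf₂_le _ (isFinitisticGenerator_sumShifts_ringPerf d
      ((ringFinDim_le_iff d).1 h.le))).trans (amp_sumShifts_ringPerf_le d)

lemma IsFinitisticGenerator.ringFinDim_lt_mul [Nontrivial A] {X : Perf A}
    (hX : IsFinitisticGenerator X) {p q : ℕ} (hp : hom (ringPerf A) 1 ≤ hom X p)
    (hq : thick X 1 ≤ thick (ringPerf A) q) : ringFinDim A < ((p * q : ℕ) : ℕ∞) := by
  have h {M : ModuleCat.{u} A} (hM : finiteResolution A M) := hX.hasProjectiveDimensionLT hp hq hM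
  cases hpq : p * q with
  | zero =>
    -- If p * q = 0, the module A itself would have projective dimension less than 0, that is, A =
    -- 0.
    have : Projective (ModuleCat.of A A) :=
      (IsProjective.iff_projective (ModuleCat.of A A)).1 inferInstance
    have := h (finiteResolution_of_projective (ModuleCat.of A A))
    rw [hpq] at this
    have hz := isZero_of_hasProjectiveDimensionLT_zero (ModuleCat.of A A)
    exact (not_subsingleton A (ModuleCat.isZero_iff_subsingleton.1 hz)).elim
  | succ k =>
    refine lt_of_le_of_lt ((ringFinDim_le_iff k).2 fun M hM => hpq ▸ h hM) ?_
    exact_mod_cast k.lt_succ_self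

lemma IsFinitisticGenerator.exists_ringFinDim_lt_add {X : Perf A} (hX : IsFinitisticGenerator X) :
    ∃ p q : ℕ, hom (ringPerf A) 1 ≤ hom X p ∧ thick X 1 ≤ thick (ringPerf A) q ∧
      ringFinDim A < ((p + q : ℕ) : ℕ∞) := by
  obtain ⟨p, hp⟩ := exists_hom_ringPerf_one_le X
  obtain ⟨q, hq⟩ := exists_thick_ringPerf X
  have hq' := thick_one_le_thick hq
  -- As hom^p(X) grows with p, the first constant can be raised until the sum exceeds the bound p *
  -- q.
  refine ⟨p + p * q + 1, q, hp.trans (hom_mono X (by lia)), hq', ?_⟩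
  refine lt_of_le_of_lt ((ringFinDim_le_iff (p * q)).2 fun M hM => ?_)
    (by exact_mod_cast (by lia : p * q < p + p * q + 1 + q))
  have := hX.hasProjectiveDimensionLT hp hq' hM
  exact hasProjectiveDimensionLT_of_ge M (p * q) _ (by simp)

end FinDim

end FinitisticDimension

open FinitisticDimension in
theorem theorem1 (A : Type u) [Ring A] :
    (ringFinDim A < ⊤ ↔ triangulatedFinDim (Perf A) < ⊤) ∧
    triangulatedFinDim (Perf A) ≤ ringFinDim A ∧
    ∀ X : Perf A, IsFinitisticGenerator X →
      (∃ p q : ℕ, hom (ringPerf A) 1 ≤ hom X p ∧ thick X 1 ≤ thick (ringPerf A) q ∧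
        ringFinDim A < ((p + q : ℕ) : ℕ∞)) ∧
      (Nontrivial A → ∀ p q : ℕ, hom (ringPerf A) 1 ≤ hom X p →
        thick X 1 ≤ thick (ringPerf A) q → ringFinDim A < ((p * q : ℕ) : ℕ∞)) := by
  refine ⟨⟨(triangulatedFinDim_le_ringFinDim A).trans_lt, fun h => ?_⟩,
    triangulatedFinDim_le_ringFinDim A,
    fun X hX => ⟨hX.exists_ringFinDim_lt_add, fun _ _ _ hp hq => hX.ringFinDim_lt_mul hp hq⟩⟩
  obtain ⟨X, h⟩ := iInf_lt_iff.1 h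
  obtain ⟨hX, -⟩ := iInf_lt_iff.1 h
  obtain ⟨p, q, -, -, h⟩ := hX.exists_ringFinDim_lt_add
  exact h.trans (ENat.natCast_lt_top _)
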